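/- **Setting.** A valuation over a set $V$ of variables is a function $V\to\mathbb Z$; $\mathrm{Val}(V)$ is the set of valuations. A *control-flow graph* $W$ of a nondeterministic recursive probabilistic program consists of a finite set $F$ of function names, a finite set $V_r$ of sampling variables, and for each $f\in F$: a finite set $L_f$ of labels with an initial label $\ell^f_{\mathrm{in}}$ and a terminal label $\ell^f_{\mathrm{out}}$, a finite set $V_f$ of program variables, and for each label $\ell\ne\ell^f_{\mathrm{out}}$ exactly one of the following: * (assignment) a single transition $(\ell,u,\ell')$ with $u:\mathrm{Val}(V_f)\times\mathrm{Val}(V_r)\to\mathrm{Val}(V_f)$; * (call) a single transition $(\ell,(g,v),\ell')$ with $g\in F$ and $v:\mathrm{Val}(V_f)\to\mathrm{Val}(V_g)$; * (branching) two transitions $(\ell,\phi,\ell_1),(\ell,\neg\phi,\ell_2)$, where $\phi$ is a propositional arithmetic predicate over $V_f$, i.e. a Boolean combination of comparisons $<,\le,>,\ge$ of integer-valued expressions over $V_f$; * (nondeterminism) two transitions $(\ell,\star,\ell_1),(\ell,\star,\ell_2)$, the then- and the else-branch. A sampling function $\Upsilon$ assigns to each $r\in V_r$ a probability distribution on $\mathbb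 Z$; put $\overline\Upsilon(\mu)=\prod_{r\in V_r}\Upsilon(r)(\mu(r))$ for $\mu\in\mathrm{Val}(V_r)$. A *stack element* is a triple $(f,\ell,\nu)$ with $f\in F$, $\ell\in L_f$, $\nu\in\mathrm{Val}(V_f)$; it is *terminal* if $\ell=\ell^f_{\mathrm{out}}$. A *configuration* is a finite word of non-terminal stack elements, its first letter being the top of the call stack. **Semantics.** The states of the Markov decision process of $W$ are the pairs $(w,\mu)$ of a configuration and a valuation $\mu\in\mathrm{Val}(V_r)$; the actions are $\tau,\mathbf{th},\mathbf{el}$. Every transition draws a new $\mu'\sim\overline\Upsilon$, and leads to $(w',\mu')$, where $w'$ is as follows. The empty configuration $\varepsilon$ stays empty under every action. A configuration $(f,\ell,\nu)\cdot w$ becomes, where terminal stack elements are always deleted: * under $\tau$ at an assignment label: $(f,\ell',u(\nu,\mu'))\cdot w$; * under $\tau$ at a call label: $(g,\ell^g_{\mathrm{in}},v(\nu))\cdot(f,\ell',\nu)\cdot w$; * under $\tau$ at a branching label: $(f,\ell_1,\nu)\cdot w$ if $\nu\models\phi$, and $(f,\ell_2,\nu)\cdot w$ otherwise; * at a nondeterministic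 label: $(f,\ell_1,\nu)\cdot w$ under $\mathbf{th}$, and $(f,\ell_2,\nu)\cdot w$ under $\mathbf{el}$. All other transition probabilities are $0$. An action is *enabled* at a state if its transition probabilities from there sum to $1$. A *history* is a nonempty finite word of states in which every step has positive probability under some action. A *scheduler* $\sigma$ maps each history to a probability distribution on the actions enabled at its last state. For a non-terminal stack element $\mathfrak c$, let $\mathbb P^\sigma_{\mathfrak c}$ be the resulting probability measure on infinite runs (infinite sequences of states starting with a one-letter configuration, all of whose nonempty finite prefixes are histories) started in the state $(\mathfrak c,\mathbf 0)$, and $\mathbb E^\sigma_{\mathfrak c}$ its expectation. The termination time of a run is $T(\{(w_n,\mu_n)\}_{n\ge 0})=\min\{n\ge 0\mid w_n=\varepsilon\}$, with $\min\emptyset=\infty$. Put $\overline T(\mathfrak c)=\sup_\sigma\mathbb E^\sigma_{\mathfrak c}(T)$ over all schedulers $\sigma$ if $\mathfrak c$ is non-terminal, and $\overline T(\mathfrak c)=0$ if $\mathfrak c$ is terminal. **Ranking measure functions.** A function $h$ from stack elements to $[0,\infty]$ is a *ranking measure function* with constant $\epsilon\in(0,\infty)$ if for all stack elements $(f,\ell,\nu)$,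 in the notation above and with $0\cdot\infty=0$: * (C1) if $\ell=\ell^f_{\mathrm{out}}$, then $h(f,\ell,\nu)=0$; * (C2) if $\ell\ne\ell^f_{\mathrm{out}}$ is an assignment label, then $\epsilon+\sum_{\mu:\,\overline\Upsilon(\mu)>0}\overline\Upsilon(\mu)\,h(f,\ell',u(\nu,\mu))\le h(f,\ell,\nu)$; * (C3) if $\ell\ne\ell^f_{\mathrm{out}}$ is a call label, then $\epsilon+h(g,\ell^g_{\mathrm{in}},v(\nu))+h(f,\ell',\nu)\le h(f,\ell,\nu)$; * (C4) if $\ell\ne\ell^f_{\mathrm{out}}$ is a branching label, then $\mathbf 1_{\nu\models\phi}\,h(f,\ell_1,\nu)+\mathbf 1_{\nu\models\neg\phi}\,h(f,\ell_2,\nu)+\epsilon\le h(f,\ell,\nu)$; * (C5) if $\ell\ne\ell^f_{\mathrm{out}}$ is a nondeterministic label, then $\max\{h(f,\ell_1,\nu),h(f,\ell_2,\nu)\}+\epsilon\le h(f,\ell,\nu)$. **Lemma (Soundness).** For every control-flow graph $W$, sampling function $\Upsilon$, ranking measure function $h$ with constant $\epsilon$, and stack element $\mathfrak c$, $$\overline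 T(\mathfrak c)\le\frac{h(\mathfrak c)}{\epsilon}.$$ -/

import Mathlib

open scoped ENNReal
open MeasureTheory

namespace RecProg

/-! ### Valuations, arithmetic expressions, predicates -/

/-- Valuations over a set `V` of (integer-valued) variables. -/
abbrev Val (V : Type) : Type := V → ℤ

/-- Arithmetic expressions over `V`, represented by their (total, integer-valued) evaluation.
No particular syntax of arithmetic operations is fixed. -/
abbrev ArithExpr (V : Type) : Type := Val V → ℤ

/-- Propositional arithmetic predicates over `V`. -/
inductive Pred (V : Type) : Type
  | lt (e e' : ArithExpr V)
  | le (e e' : ArithExpr V)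
  | gt (e e' : ArithExpr V)
  | ge (e e' : ArithExpr V)
  | and (φ ψ : Pred V)
  | or (φ ψ : Pred V)
  | not (φ : Pred V)

/-- The satisfaction relation `ν ⊨ φ`. -/
def Pred.Sat {V : Type} (ν : Val V) : Pred V → Prop
  | .lt e e' => e ν < e' ν
  | .le e e' => e ν ≤ e' ν
  | .gt e e' => e ν > e' ν
  | .ge e e' => e ν ≥ e' ν
  | .and φ ψ => φ.Sat ν ∧ ψ.Sat ν
  | .or φ ψ => φ.Sat ν ∨ ψ.Sat ν
  | .not φ => ¬ φ.Sat ν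

/-! ### Control-flow graphs -/

/-- What the transition relation says at one non-terminal label `ℓ` of a function whose labels are
`Loc` and whose program variables are `PV`. The constructor tells the kind of the label.
* `assign u ℓ'`: assignment label, the only triple from `ℓ` is `(ℓ, u, ℓ')`;
* `call g v ℓ'`: call label, the only triple from `ℓ` is `(ℓ, (g, v), ℓ')`;
* `branch φ ℓ₁ ℓ₂`: branching label, the triples from `ℓ` are `(ℓ, φ, ℓ₁)` and `(ℓ, ¬φ, ℓ₂)`;
* `nondet ℓ₁ ℓ₂`: nondeterministic label, the triples from `ℓ` are `(ℓ, ⋆, ℓ₁)` (then-branch) and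
  `(ℓ, ⋆, ℓ₂)` (else-branch). -/
inductive Instr (F : Type) (PVar : F → Type) (VR : Type) (Loc PV : Type) : Type
  | assign (u : Val PV → Val VR → Val PV) (next : Loc)
  | call (g : F) (v : Val PV → Val (PVar g)) (next : Loc)
  | branch (φ : Pred PV) (thn els : Loc)
  | nondet (thn els : Loc)

/-- Control-flow graphs of nondeterministic recursive probabilistic programs. -/
structure CFG where
  /-- function names -/
  F : Type
  [finiteF : Finite F]
  /-- sampling variables -/
  VR : Type
  [fintypeVR : Fintype VR]
  /-- labels of a function -/
  Loc : F → Type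
  [finiteLoc : ∀ f, Finite (Loc f)]
  /-- program variables of a function -/
  PVar : F → Type
  [finitePVar : ∀ f, Finite (PVar f)]
  /-- initial label of a function -/
  lin : ∀ f, Loc f
  /-- terminal label of a function -/
  lout : ∀ f, Loc f
  /-- the transitions from the non-terminal labels -/
  instr : ∀ f, {ℓ : Loc f // ℓ ≠ lout f} → Instr F PVar VR (Loc f) (PVar f)

attribute [instance] CFG.finiteF CFG.fintypeVR CFG.finiteLoc CFG.finitePVar

namespace CFG

variable (W : CFG)

/-! ### Stack elements, configurations, states -/

/-- Stack elements `(f, ℓ, ν)`. -/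
structure StackElem where
  fn : W.F
  label : W.Loc fn
  val : Val (W.PVar fn)

variable {W}

/-- A stack element is terminal if its label is the terminal label of its function. -/
def StackElem.Terminal (c : W.StackElem) : Prop := c.label = W.lout c.fn

variable (W)

/-- Configurations: finite words of non-terminal stack elements; the head is the top of the call
stack. -/
abbrev Config : Type := List {c : W.StackElem // ¬ c.Terminal}

/-- States of the Markov decision process: a configuration and the sampling of the previous step. -/
abbrev State : Type := W.Config × Val W.VR

/-- Actions. -/
inductive Action : Type
  | tau
  | th
  | el

/-- Sampling functions: a discrete probability distribution over `ℤ` for every sampling variable. -/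
abbrev SamplingFunction : Type := W.VR → PMF ℤ

variable {W}

lemma hasSum_prod_sampling (Υ : W.SamplingFunction) :
    HasSum (fun μ : Val W.VR => ∏ r, Υ r (μ r)) 1 := by
  have h : ∀ μ : Val W.VR, ∏ r, Υ r (μ r) = Measure.pi (fun r => (Υ r).toMeasure) {μ} := by
    intro μ
    rw [Measure.pi_singleton]
    exact Finset.prod_congr rfl fun r _ =>
      ((Υ r).toMeasure_apply_singleton _ (measurableSet_singleton _)).symm
  have h1 : ∑' μ : Val W.VR, ∏ r, Υ r (μ r) = 1 := by
    simp_rw [h]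
    have := Measure.tsum_indicator_apply_singleton
      (Measure.pi (fun r => (Υ r).toMeasure)) Set.univ MeasurableSet.univ
    simpa using this
  rw [← h1]
  exact ENNReal.summable.hasSum

/-- The product distribution of the sampling variables. -/
noncomputable def samplePMF (Υ : W.SamplingFunction) : PMF (Val W.VR) :=
  ⟨fun μ => ∏ r, Υ r (μ r), hasSum_prod_sampling Υ⟩

open Classical in
/-- Put `(f, ℓ, ν)` on top of the stack `w`, unless `ℓ` is the terminal label of `f`. -/
noncomputable def push (f : W.F) (ℓ : W.Loc f) (ν : Val (W.PVar f)) (w : W.Config) : W.Config :=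
  if h : ℓ = W.lout f then w else ⟨⟨f, ℓ, ν⟩, h⟩ :: w

open Classical in
/-- The configuration reached from `(f, ℓ, ν) · w` by the action `a` when the sampling is `μ'`, if
`i` is the instruction at `ℓ`; `none` if `a` is not an action for this kind of instruction. -/
noncomputable def execInstr (f : W.F) (ν : Val (W.PVar f)) (w : W.Config) :
    Instr W.F W.PVar W.VR (W.Loc f) (W.PVar f) → Action → Val W.VR → Option W.Config
  | .assign u ℓ', .tau, μ' => some (push f ℓ' (u ν μ') w)
  | .call g v ℓ', .tau, _ => some (push g (W.lin g) (v ν) (push f ℓ' ν w))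
  | .branch φ ℓ₁ ℓ₂, .tau, _ => some (push f (if φ.Sat ν then ℓ₁ else ℓ₂) ν w)
  | .nondet ℓ₁ _, .th, _ => some (push f ℓ₁ ν w)
  | .nondet _ ℓ₂, .el, _ => some (push f ℓ₂ ν w)
  | _, _, _ => none

/-- The configuration reached from `c · w` by the action `a` when the sampling is `μ'`;
`none` if `a` is not an action for the kind of the label of `c`. -/
noncomputable def succConfig (c : {c : W.StackElem // ¬ c.Terminal}) (w : W.Config) (a : Action)
    (μ' : Val W.VR) : Option W.Config :=
  execInstr c.1.fn c.1.val w (W.instr c.1.fn ⟨c.1.label, c.2⟩) a μ'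

/-! ### The Markov decision process -/

open Classical in
/-- The probability transition function of the Markov decision process. -/
noncomputable def trans (Υ : W.SamplingFunction) : W.State → Action → W.State → ℝ≥0∞
  | ([], _), _, (w', μ') => if w' = [] then samplePMF Υ μ' else 0
  | (c :: w, _), a, (w', μ') => if succConfig c w a μ' = some w' then samplePMF Υ μ' else 0

/-- The action `a` is enabled at the state `s`. -/
def Enabled (Υ : W.SamplingFunction) (s : W.State) (a : Action) : Prop :=
  ∑' s', trans Υ s a s' = 1

/-- In the finite word `s₀ … sₙ` of states, every step has positive probability under some
action. -/
def IsHistory (Υ : W.SamplingFunction) (n : ℕ) (x : Finset.Iic n → W.State) : Prop :=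
  ∀ k (hk : k < n), ∃ a, 0 < trans Υ (x ⟨k, Finset.mem_Iic.2 hk.le⟩) a
    (x ⟨k + 1, Finset.mem_Iic.2 hk⟩)

/-- Histories: finite words `s₀ … sₙ` of states (`n = len`), where every step has positive
probability under some action. -/
structure History (Υ : W.SamplingFunction) where
  len : ℕ
  word : Finset.Iic len → W.State
  isHistory : IsHistory Υ len word

/-- The last state of a history. -/
def History.last {Υ : W.SamplingFunction} (ρ : History Υ) : W.State :=
  ρ.word ⟨ρ.len, Finset.mem_Iic.2 le_rfl⟩

/-- The prefix `s₀ … sₖ` of a history `s₀ … sₙ`, for `k ≤ n`. -/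
def History.take {Υ : W.SamplingFunction} (ρ : History Υ) (k : ℕ) (hk : k ≤ ρ.len) : History Υ where
  len := k
  word i := ρ.word ⟨i, Finset.mem_Iic.2 ((Finset.mem_Iic.1 i.2).trans hk)⟩
  isHistory j hj := ρ.isHistory j (hj.trans_le hk)

/-- Schedulers map every history to a discrete probability distribution over the actions that are
enabled at its last state. -/
abbrev Scheduler (Υ : W.SamplingFunction) : Type :=
  (ρ : History Υ) → PMF {a : Action // Enabled Υ ρ.last a}

/-- The probability of the step from the history `ρ` to the history `ρ · s` in the Markov chain
obtained by applying the scheduler `σ`. -/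
noncomputable def stepProb {Υ : W.SamplingFunction} (σ : Scheduler Υ) (ρ : History Υ)
    (s : W.State) : ℝ≥0∞ :=
  ∑' a, σ ρ a * trans Υ ρ.last a s

lemma hasSum_stepProb {Υ : W.SamplingFunction} (σ : Scheduler Υ) (ρ : History Υ) :
    HasSum (stepProb σ ρ) 1 := by
  have h : ∑' s, stepProb σ ρ s = 1 := by
    unfold stepProb
    rw [ENNReal.tsum_comm]
    simp_rw [ENNReal.tsum_mul_left]
    rw [← (σ ρ).tsum_coe]
    refine tsum_congr fun a => ?_
    have := a.2
    unfold Enabled at this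
    rw [this, mul_one]
  rw [← h]
  exact ENNReal.summable.hasSum

/-- `stepProb σ ρ` as a distribution of the next state. -/
noncomputable def stepPMF {Υ : W.SamplingFunction} (σ : Scheduler Υ) (ρ : History Υ) :
    PMF W.State :=
  ⟨stepProb σ ρ, hasSum_stepProb σ ρ⟩

/-! ### Infinite runs and their probability measures -/

instance : Countable W.StackElem := by
  have : Function.Injective (fun c : W.StackElem =>
      (⟨c.fn, c.label, c.val⟩ : Σ f : W.F, W.Loc f × Val (W.PVar f))) := by
    rintro ⟨f, l, v⟩ ⟨f', l', v'⟩ h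
    simp only [Sigma.mk.injEq] at h
    obtain ⟨rfl, h⟩ := h
    simp only [heq_eq_eq, Prod.mk.injEq] at h
    obtain ⟨rfl, rfl⟩ := h
    rfl
  exact this.countable

instance : MeasurableSpace W.State := ⊤

instance : DiscreteMeasurableSpace W.State := ⟨fun _ => trivial⟩

open Classical in
/-- The law of the next state given the states up to time `n`. (Words which are not histories are
never reached; the value there is irrelevant.) -/
noncomputable def stepKernel {Υ : W.SamplingFunction} (σ : Scheduler Υ) (n : ℕ) :
    ProbabilityTheory.Kernel (Finset.Iic n → W.State) W.State :=
  ProbabilityTheory.Kernel.ofFunOfCountable fun x =>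
    if h : IsHistory Υ n x then (stepPMF σ ⟨n, x, h⟩).toMeasure
    else Measure.dirac (x ⟨n, Finset.mem_Iic.2 le_rfl⟩)

open Classical in
instance {Υ : W.SamplingFunction} (σ : Scheduler Υ) (n : ℕ) :
    ProbabilityTheory.IsMarkovKernel (stepKernel σ n) := by
  refine ⟨fun x => ?_⟩
  change IsProbabilityMeasure (dite _ _ _)
  split_ifs <;> infer_instance

/-- The initial state of the Markov chain with initial stack element `c`. -/
def initState (c : {c : W.StackElem // ¬ c.Terminal}) : W.State := ([c], 0)

/-- The law of the sequence of states, on all sequences of states. -/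
noncomputable def pathMeasure {Υ : W.SamplingFunction} (σ : Scheduler Υ)
    (c : {c : W.StackElem // ¬ c.Terminal}) : Measure (ℕ → W.State) :=
  ProbabilityTheory.Kernel.trajMeasure (X := fun _ => W.State) (Measure.dirac (initState c))
    (stepKernel σ)

instance {Υ : W.SamplingFunction} (σ : Scheduler Υ) (c : {c : W.StackElem // ¬ c.Terminal}) :
    IsProbabilityMeasure (pathMeasure σ c) := by
  unfold pathMeasure; infer_instance

/-- Infinite runs: sequences of states that start in a configuration consisting of one non-terminal
stack element, and all of whose finite prefixes are histories. -/
def IsRun (Υ : W.SamplingFunction) (ω : ℕ → W.State) : Prop :=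
  (∃ c, (ω 0).1 = [c]) ∧ ∀ n, ∃ a, 0 < trans Υ (ω n) a (ω (n + 1))

/-- The sample space of infinite runs, with the σ-algebra induced by the coordinates, which is the
one generated by the (countably many) cylinder sets. -/
abbrev Run (Υ : W.SamplingFunction) : Type := {ω : ℕ → W.State // IsRun Υ ω}

/-- The probability measure on the infinite runs for the scheduler `σ` and the initial stack
element `c`. -/
noncomputable def runMeasure {Υ : W.SamplingFunction} (σ : Scheduler Υ)
    (c : {c : W.StackElem // ¬ c.Terminal}) : Measure (Run Υ) :=
  (pathMeasure σ c).comap Subtype.val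

/-- The cylinder set of all infinite runs with prefix `ρ`. -/
def cyl {Υ : W.SamplingFunction} (ρ : History Υ) : Set (Run Υ) :=
  {ω | ∀ i : Finset.Iic ρ.len, ω.1 i = ρ.word i}

/-- The restriction to the first `n + 1` coordinates of a word of length `n + 2`. -/
def initWord {n : ℕ} (x : Finset.Iic (n + 1) → W.State) : Finset.Iic n → W.State :=
  fun i => x ⟨i, Finset.mem_Iic.2 ((Finset.mem_Iic.1 i.2).trans n.le_succ)⟩

lemma pathMeasure_zero {Υ : W.SamplingFunction} (σ : Scheduler Υ)
    (c : {c : W.StackElem // ¬ c.Terminal}) :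
    (pathMeasure σ c).map (Preorder.frestrictLe (π := fun _ => W.State) 0) =
      Measure.dirac (fun _ => initState c) := by
  unfold pathMeasure ProbabilityTheory.Kernel.trajMeasure
  rw [Measure.map_comp _ _ (by fun_prop), ProbabilityTheory.Kernel.traj_map_frestrictLe,
    ProbabilityTheory.Kernel.partialTraj_self, Measure.id_comp,
    Measure.map_dirac' (MeasurableEquiv.measurable _)]
  congr 1

lemma pathMeasure_succ {Υ : W.SamplingFunction} (σ : Scheduler Υ)
    (c : {c : W.StackElem // ¬ c.Terminal}) (n : ℕ) (x : Finset.Iic (n + 1) → W.State) :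
    pathMeasure σ c {ω | ∀ i : Finset.Iic (n + 1), ω i = x i} =
      pathMeasure σ c {ω | ∀ i : Finset.Iic n, ω i = initWord x i} *
        stepKernel σ n (initWord x) {x ⟨n + 1, Finset.mem_Iic.2 le_rfl⟩} := by
  have key := ProbabilityTheory.Kernel.map_frestrictLe_trajMeasure_compProd_eq_map_trajMeasure
    (X := fun _ => W.State) (κ := stepKernel σ) (μ₀ := Measure.dirac (initState c)) (a := n)
  have h := congrArg (fun m => m ({initWord x} ×ˢ {x ⟨n + 1, Finset.mem_Iic.2 le_rfl⟩})) key
  beta_reduce at h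
  rw [Measure.compProd_apply_prod (measurableSet_singleton _) (measurableSet_singleton _),
    lintegral_singleton, Measure.map_apply (by fun_prop) (measurableSet_singleton _),
    Measure.map_apply (by fun_prop)
      ((measurableSet_singleton _).prod (measurableSet_singleton _)), mul_comm] at h
  have e1 : {ω : ℕ → W.State | ∀ i : Finset.Iic (n + 1), ω i = x i} =
      (fun ω => (Preorder.frestrictLe (π := fun _ => W.State) n ω, ω (n + 1))) ⁻¹'
        ({initWord x} ×ˢ {x ⟨n + 1, Finset.mem_Iic.2 le_rfl⟩}) := by
    ext ω
    simp only [Set.mem_ofPred_eq, Set.mem_preimage, Set.mem_prod, Set.mem_singleton_iff]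
    constructor
    · intro hω
      exact ⟨funext fun i => hω ⟨i, _⟩, hω ⟨n + 1, _⟩⟩
    · rintro ⟨h1, h2⟩ ⟨i, hi⟩
      rcases (Finset.mem_Iic.1 hi).lt_or_eq with h | rfl
      · exact congrFun h1 ⟨i, Finset.mem_Iic.2 (Nat.lt_succ_iff.1 h)⟩
      · exact h2
  have e2 : {ω : ℕ → W.State | ∀ i : Finset.Iic n, ω i = initWord x i} =
      (Preorder.frestrictLe (π := fun _ => W.State) n) ⁻¹' {initWord x} := by
    ext ω
    simp only [Set.mem_ofPred_eq, Set.mem_preimage, Set.mem_singleton_iff, funext_iff]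
    rfl
  rw [e1, e2]
  exact h.symm

open Classical in
lemma stepKernel_singleton {Υ : W.SamplingFunction} (σ : Scheduler Υ) (ρ : History Υ)
    (s : W.State) : stepKernel σ ρ.len ρ.word {s} = stepProb σ ρ s := by
  change (dite _ _ _ : Measure W.State) {s} = _
  rw [dif_pos ρ.isHistory, PMF.toMeasure_apply_singleton _ _ (measurableSet_singleton _)]
  rfl

lemma ae_isRun {Υ : W.SamplingFunction} (σ : Scheduler Υ)
    (c : {c : W.StackElem // ¬ c.Terminal}) : ∀ᵐ ω ∂pathMeasure σ c, IsRun Υ ω := by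
  have h0 : ∀ᵐ ω ∂pathMeasure σ c, ω 0 = initState c := by
    have : ∀ᵐ x ∂(pathMeasure σ c).map (Preorder.frestrictLe (π := fun _ => W.State) 0),
        x ⟨0, Finset.mem_Iic.2 le_rfl⟩ = initState c := by
      rw [pathMeasure_zero, ae_dirac_eq]
      rfl
    exact ae_of_ae_map (by fun_prop) this
  have hs : ∀ n, ∀ᵐ ω ∂pathMeasure σ c,
      IsHistory Υ n (fun i => ω i) → ∃ a, 0 < trans Υ (ω n) a (ω (n + 1)) := by
    intro n
    have : ∀ x : Finset.Iic (n + 1) → W.State, ∀ᵐ ω ∂pathMeasure σ c,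
        (∀ i : Finset.Iic (n + 1), ω i = x i) →
        IsHistory Υ n (fun i => ω i) → ∃ a, 0 < trans Υ (ω n) a (ω (n + 1)) := by
      intro x
      by_cases hx : IsHistory Υ n (initWord x) ∧ ∀ a,
          trans Υ (x ⟨n, Finset.mem_Iic.2 n.le_succ⟩) a (x ⟨n + 1, Finset.mem_Iic.2 le_rfl⟩) = 0
      · have hz : pathMeasure σ c {ω | ∀ i : Finset.Iic (n + 1), ω i = x i} = 0 := by
          rw [pathMeasure_succ, stepKernel_singleton σ ⟨n, initWord x, hx.1⟩]
          have : stepProb σ ⟨n, initWord x, hx.1⟩ (x ⟨n + 1, Finset.mem_Iic.2 le_rfl⟩) = 0 := by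
            unfold stepProb
            refine ENNReal.tsum_eq_zero.2 fun a => ?_
            exact mul_eq_zero_of_right _ (hx.2 a)
          rw [this, mul_zero]
        filter_upwards [measure_eq_zero_iff_ae_notMem.1 hz] with ω hω h1
        exact absurd h1 hω
      · refine Filter.Eventually.of_forall fun ω hω hh => ?_
        by_contra hcon
        refine hx ⟨?_, fun a => ?_⟩
        · convert hh using 1
          funext i
          exact (hω ⟨i, _⟩).symm
        · rw [← hω, ← hω]
          by_contra hne
          exact hcon ⟨a, pos_iff_ne_zero.2 hne⟩
    filter_upwards [ae_all_iff.2 this] with ω hω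
    exact hω (fun i => ω i) fun _ => rfl
  filter_upwards [h0, ae_all_iff.2 hs] with ω hω0 hω
  refine ⟨⟨c, by rw [hω0]; rfl⟩, fun n => ?_⟩
  induction n using Nat.strong_induction_on with
  | _ n ih => exact hω n fun k hk => ih k hk

lemma measurableSet_isRun (Υ : W.SamplingFunction) : MeasurableSet {ω | IsRun Υ ω} := by
  unfold IsRun
  refine MeasurableSet.inter ?_ ?_
  · have : Measurable fun ω : ℕ → W.State => ω 0 := by fun_prop
    exact this (MeasurableSet.of_discrete (s := {s : W.State | ∃ c, s.1 = [c]}))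
  · change MeasurableSet {ω : ℕ → W.State | ∀ n, ∃ a, 0 < trans Υ (ω n) a (ω (n + 1))}
    rw [Set.ofPred_forall]
    refine MeasurableSet.iInter fun n => ?_
    have : Measurable fun ω : ℕ → W.State => (ω n, ω (n + 1)) := by fun_prop
    exact this (MeasurableSet.of_discrete
      (s := {p : W.State × W.State | ∃ a, 0 < trans Υ p.1 a p.2}))

lemma runMeasure_apply {Υ : W.SamplingFunction} (σ : Scheduler Υ)
    (c : {c : W.StackElem // ¬ c.Terminal}) (A : Set (ℕ → W.State)) :
    runMeasure σ c (Subtype.val ⁻¹' A) = pathMeasure σ c A := by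
  unfold runMeasure
  have h := comap_subtype_coe_apply (measurableSet_isRun Υ) (pathMeasure σ c) (Subtype.val ⁻¹' A)
  refine h.trans ?_
  rw [Subtype.image_preimage_coe, Set.inter_comm]
  exact measure_inter_conull (ae_isRun σ c)

instance {Υ : W.SamplingFunction} (σ : Scheduler Υ) (c : {c : W.StackElem // ¬ c.Terminal}) :
    IsProbabilityMeasure (runMeasure σ c) :=
  ⟨by rw [← Set.preimage_univ, runMeasure_apply, measure_univ]⟩

open Classical in
/-- The values of the probability measure on cylinder sets, which characterize it. -/
theorem runMeasure_cyl {Υ : W.SamplingFunction} (σ : Scheduler Υ)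
    (c : {c : W.StackElem // ¬ c.Terminal}) (ρ : History Υ) :
    runMeasure σ c (cyl ρ) =
      if ρ.word ⟨0, Finset.mem_Iic.2 ρ.len.zero_le⟩ = initState c then
        ∏ k : Fin ρ.len, stepProb σ (ρ.take k k.2.le) (ρ.word ⟨k + 1, Finset.mem_Iic.2 k.2⟩)
      else 0 := by
  change runMeasure σ c (Subtype.val ⁻¹' {ω | ∀ i : Finset.Iic ρ.len, ω i = ρ.word i}) = _
  rw [runMeasure_apply]
  have main : ∀ n (ρ : History Υ), ρ.len = n →
      pathMeasure σ c {ω | ∀ i : Finset.Iic ρ.len, ω i = ρ.word i} =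
      if ρ.word ⟨0, Finset.mem_Iic.2 ρ.len.zero_le⟩ = initState c then
        ∏ k : Fin ρ.len, stepProb σ (ρ.take k k.2.le) (ρ.word ⟨k + 1, Finset.mem_Iic.2 k.2⟩)
      else 0 := by
    intro n
    induction n with
    | zero =>
      rintro ⟨n, x, hx⟩ rfl
      have e : {ω : ℕ → W.State | ∀ i : Finset.Iic 0, ω i = x i} =
          (Preorder.frestrictLe (π := fun _ => W.State) 0) ⁻¹' {x} := by
        ext ω
        simp only [Set.mem_ofPred_eq, Set.mem_preimage, Set.mem_singleton_iff, funext_iff]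
        rfl
      have e' : (fun _ => initState c) = x ↔ x ⟨0, Finset.mem_Iic.2 le_rfl⟩ = initState c := by
        constructor
        · rintro rfl; rfl
        · intro h
          funext ⟨i, hi⟩
          obtain rfl : i = 0 := by simpa using hi
          exact h.symm
      simp only
      rw [e, ← Measure.map_apply (by fun_prop) (measurableSet_singleton _), pathMeasure_zero,
        Measure.dirac_apply' _ (measurableSet_singleton _)]
      simp [Set.indicator_apply, e']
    | succ n ih =>
      rintro ⟨m, x, hx⟩ hm
      obtain rfl : m = n + 1 := hm
      simp only
      have h1 := ih ((⟨n + 1, x, hx⟩ : History Υ).take n n.le_succ) rfl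
      have h2 := stepKernel_singleton σ ((⟨n + 1, x, hx⟩ : History Υ).take n n.le_succ)
        (x ⟨n + 1, Finset.mem_Iic.2 le_rfl⟩)
      rw [pathMeasure_succ, Fin.prod_univ_castSucc]
      refine (congrArg₂ (· * ·) h1 h2).trans ?_
      simp only [ite_mul, zero_mul]
      rfl
  exact main _ ρ rfl

/-! ### Termination time and ranking measure functions -/

/-- The termination time of an infinite run: the first time the stack is empty, `∞` if it never
is. -/
noncomputable def terminationTime {Υ : W.SamplingFunction} (ω : Run Υ) : ℝ≥0∞ :=
  ⨅ (n : ℕ) (_ : (ω.1 n).1 = []), (n : ℝ≥0∞)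

open Classical in
/-- The function `T̄`: the supremum over all schedulers of the expected termination time if `c` is
non-terminal, and `0` otherwise. -/
noncomputable def supExpectedTime (Υ : W.SamplingFunction) (c : W.StackElem) : ℝ≥0∞ :=
  if h : c.Terminal then 0
  else ⨆ σ : Scheduler Υ, ∫⁻ ω, terminationTime ω ∂runMeasure σ ⟨c, h⟩

open Classical in
/-- `h` is a ranking measure function with constant `ε`. -/
structure IsRankingMeasureFunction (Υ : W.SamplingFunction) (h : W.StackElem → ℝ≥0∞) (ε : ℝ) :
    Prop where
  pos : 0 < ε
  terminal : ∀ f ν, h ⟨f, W.lout f, ν⟩ = 0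
  assign : ∀ f ℓ (hℓ : ℓ ≠ W.lout f) ν u ℓ', W.instr f ⟨ℓ, hℓ⟩ = .assign u ℓ' →
    ENNReal.ofReal ε + ∑' μ : (samplePMF Υ).support, samplePMF Υ μ * h ⟨f, ℓ', u ν μ⟩
      ≤ h ⟨f, ℓ, ν⟩
  call : ∀ f ℓ (hℓ : ℓ ≠ W.lout f) ν g v ℓ', W.instr f ⟨ℓ, hℓ⟩ = .call g v ℓ' →
    ENNReal.ofReal ε + h ⟨g, W.lin g, v ν⟩ + h ⟨f, ℓ', ν⟩ ≤ h ⟨f, ℓ, ν⟩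
  branch : ∀ f ℓ (hℓ : ℓ ≠ W.lout f) ν φ ℓ₁ ℓ₂, W.instr f ⟨ℓ, hℓ⟩ = .branch φ ℓ₁ ℓ₂ →
    (if φ.Sat ν then 1 else 0) * h ⟨f, ℓ₁, ν⟩ + (if φ.not.Sat ν then 1 else 0) * h ⟨f, ℓ₂, ν⟩
      + ENNReal.ofReal ε ≤ h ⟨f, ℓ, ν⟩
  nondet : ∀ f ℓ (hℓ : ℓ ≠ W.lout f) ν ℓ₁ ℓ₂, W.instr f ⟨ℓ, hℓ⟩ = .nondet ℓ₁ ℓ₂ →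
    max (h ⟨f, ℓ₁, ν⟩) (h ⟨f, ℓ₂, ν⟩) + ENNReal.ofReal ε ≤ h ⟨f, ℓ, ν⟩

end CFG

end RecProg

namespace RecProg

namespace CFG

variable {W : CFG}

/-! The proof is a supermartingale argument carried out with integrals in `[0,∞]`. Summing `h` over
the call stack gives a potential on configurations. The conditions (C2)–(C5) say that each action
lowers its expectation by at least `ε` while the stack is nonempty; the additive form of (C3)
matches the fact that a call replaces the top element by two (`tsum_trans_add_le`). Averaging over
the scheduler's choice and integrating over the past gives one inequality per time step
(`lintegral_stepCost_add_le`), and these telescope: the expected total cost, at `ε` per step with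
nonempty stack, is at most the initial potential, which is `h` of the start element
(`sum_lintegral_stepCost_add_le`). On each run this total cost dominates `ε` times the termination
time (`terminationTime_mul_le`). -/

/-- The extension of a function on stack elements to configurations, by summing over the stack. -/
noncomputable def stackSum (h : W.StackElem → ℝ≥0∞) (w : W.Config) : ℝ≥0∞ :=
  (w.map fun c => h c.1).sum

@[simp]
lemma stackSum_nil (h : W.StackElem → ℝ≥0∞) : stackSum h [] = 0 := rfl

@[simp]
lemma stackSum_cons (h : W.StackElem → ℝ≥0∞) (c : {c : W.StackElem // ¬ c.Terminal})
    (w : W.Config) : stackSum h (c :: w) = h c.1 + stackSum h w := by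
  simp [stackSum]

/-- Deleting a terminal element instead of pushing it only loses a nonnegative summand. -/
lemma stackSum_push_le (h : W.StackElem → ℝ≥0∞) (f : W.F) (ℓ : W.Loc f) (ν : Val (W.PVar f))
    (w : W.Config) : stackSum h (push f ℓ ν w) ≤ h ⟨f, ℓ, ν⟩ + stackSum h w := by
  unfold push
  split_ifs
  · exact le_add_self
  · simp

lemma tsum_trans_nil_mul (Υ : W.SamplingFunction) (μ : Val W.VR) (a : Action)
    (g : W.Config → ℝ≥0∞) (hg : g [] = 0) :
    ∑' s', trans Υ ([], μ) a s' * g s'.1 = 0 := by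
  refine ENNReal.tsum_eq_zero.2 ?_
  rintro ⟨w', μ'⟩
  by_cases hw : w' = []
  · subst hw; simp [hg]
  · simp [trans, hw]

/-- The expectation of a function of the next configuration. -/
lemma tsum_trans_cons_mul (Υ : W.SamplingFunction) (c : {c : W.StackElem // ¬ c.Terminal})
    (w : W.Config) (μ : Val W.VR) (a : Action) (g : W.Config → ℝ≥0∞) :
    ∑' s', trans Υ (c :: w, μ) a s' * g s'.1 =
      ∑' μ', samplePMF Υ μ' * ((succConfig c w a μ').elim 0 g) := by
  classical
  -- Once the sampling is fixed, at most one configuration carries mass; the default `0` covers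
  -- actions that do not fit the label, whose transition probabilities all vanish.
  rw [ENNReal.tsum_prod', ENNReal.tsum_comm]
  refine tsum_congr fun μ' => ?_
  cases hs : succConfig c w a μ' with
  | none => simp [trans, hs]
  | some w₀ =>
    rw [tsum_eq_single w₀]
    · simp [trans, hs]
    · intro w' hw'
      simp [trans, hs, hw'.symm]

lemma PMF_tsum_mul_le {α : Type*} (p : PMF α) {g : α → ℝ≥0∞} {b : ℝ≥0∞} (hg : ∀ x, g x ≤ b) :
    ∑' x, p x * g x ≤ b := by
  calc ∑' x, p x * g x ≤ ∑' x, p x * b := by gcongr; exact hg _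
    _ = b := by rw [ENNReal.tsum_mul_right, p.tsum_coe, one_mul]

/-! ### Expected decrease of the stack sum -/

section Ranking

variable {Υ : W.SamplingFunction} {h : W.StackElem → ℝ≥0∞} {ε : ℝ}

/-- Under every action, the expectation of the stack sum decreases by at least `ε` as long as the
stack is not empty. -/
lemma IsRankingMeasureFunction.tsum_trans_add_le (hh : IsRankingMeasureFunction Υ h ε)
    (c : {c : W.StackElem // ¬ c.Terminal}) (w : W.Config) (μ : Val W.VR) (a : Action) :
    ENNReal.ofReal ε + ∑' s', trans Υ (c :: w, μ) a s' * stackSum h s'.1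
      ≤ stackSum h (c :: w) := by
  rw [tsum_trans_cons_mul, stackSum_cons]
  obtain ⟨⟨f, ℓ, ν⟩, hc⟩ := c
  have hℓ : ℓ ≠ W.lout f := hc
  unfold succConfig
  simp only
  have push_le := stackSum_push_le h
  cases hi : W.instr f ⟨ℓ, hℓ⟩ with
  | assign u ℓ' =>
    have key := hh.assign f ℓ hℓ ν u ℓ' hi
    -- Samplings outside the support have weight `0`, so the sum in (C2) may run over all
    -- valuations.
    rw [tsum_subtype_eq_of_support_subset (f := fun μ => samplePMF Υ μ * h ⟨f, ℓ', u ν μ⟩)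
      (fun x hx => by simp_all)] at key
    calc _ ≤ ENNReal.ofReal ε +
          ∑' μ', samplePMF Υ μ' * (h ⟨f, ℓ', u ν μ'⟩ + stackSum h w) := by
          gcongr with μ'
          -- An action that does not fit the label has total mass `0`, so the bound is trivial
          -- there; the same holds in the other cases.
          cases a with
          | tau => exact push_le _ _ _ _
          | th => exact zero_le
          | el => exact zero_le
      _ = (ENNReal.ofReal ε + ∑' μ', samplePMF Υ μ' * h ⟨f, ℓ', u ν μ'⟩) + stackSum h w := by
          simp_rw [mul_add]
          rw [ENNReal.tsum_add, ENNReal.tsum_mul_right, PMF.tsum_coe, one_mul, add_assoc]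
      _ ≤ _ := by gcongr
  | call g v ℓ' =>
    have key := hh.call f ℓ hℓ ν g v ℓ' hi
    calc _ ≤ ENNReal.ofReal ε + (h ⟨g, W.lin g, v ν⟩ + (h ⟨f, ℓ', ν⟩ + stackSum h w)) := by
          gcongr
          refine PMF_tsum_mul_le _ fun μ' => ?_
          cases a with
          | tau => exact (push_le _ _ _ _).trans (by gcongr; exact push_le _ _ _ _)
          | th => exact zero_le
          | el => exact zero_le
      _ = (ENNReal.ofReal ε + h ⟨g, W.lin g, v ν⟩ + h ⟨f, ℓ', ν⟩) + stackSum h w := by ring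
      _ ≤ _ := by gcongr
  | branch φ ℓ₁ ℓ₂ =>
    classical
    have key := hh.branch f ℓ hℓ ν φ ℓ₁ ℓ₂ hi
    have key' : ENNReal.ofReal ε + h ⟨f, if φ.Sat ν then ℓ₁ else ℓ₂, ν⟩ ≤ h ⟨f, ℓ, ν⟩ := by
      rw [add_comm]
      by_cases hφ : φ.Sat ν <;> simpa [Pred.Sat, hφ] using key
    calc _ ≤ ENNReal.ofReal ε + (h ⟨f, if φ.Sat ν then ℓ₁ else ℓ₂, ν⟩ + stackSum h w) := by
          gcongr
          refine PMF_tsum_mul_le _ fun μ' => ?_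
          cases a with
          | tau => simpa [execInstr] using push_le f (if φ.Sat ν then ℓ₁ else ℓ₂) ν w
          | th => exact zero_le
          | el => exact zero_le
      _ ≤ _ := by rw [← add_assoc]; gcongr
  | nondet ℓ₁ ℓ₂ =>
    have key := hh.nondet f ℓ hℓ ν ℓ₁ ℓ₂ hi
    rw [add_comm] at key
    calc _ ≤ ENNReal.ofReal ε + (max (h ⟨f, ℓ₁, ν⟩) (h ⟨f, ℓ₂, ν⟩) + stackSum h w) := by
          gcongr
          refine PMF_tsum_mul_le _ fun μ' => ?_
          cases a with
          | tau => exact zero_le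
          | th => exact (push_le _ _ _ _).trans (by gcongr; exact le_max_left _ _)
          | el => exact (push_le _ _ _ _).trans (by gcongr; exact le_max_right _ _)
      _ ≤ _ := by rw [← add_assoc]; gcongr

/-- The function with value `e` on nonempty configurations and `0` on the empty one. -/
noncomputable def stepCost (e : ℝ≥0∞) : W.Config → ℝ≥0∞
  | [] => 0
  | _ :: _ => e

lemma IsRankingMeasureFunction.stepCost_add_tsum_trans_le (hh : IsRankingMeasureFunction Υ h ε)
    (s : W.State) (a : Action) :
    stepCost (ENNReal.ofReal ε) s.1 + ∑' s', trans Υ s a s' * stackSum h s'.1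
      ≤ stackSum h s.1 := by
  obtain ⟨_ | ⟨c, w⟩, μ⟩ := s
  · rw [tsum_trans_nil_mul _ _ _ _ (stackSum_nil h)]
    simp [stepCost]
  · exact hh.tsum_trans_add_le c w μ a

/-- A randomized choice is a convex combination of actions, and the bound holds for each of them;
the cost depends on the state only, so it can be averaged too. -/
lemma IsRankingMeasureFunction.stepCost_add_tsum_stepProb_le
    (hh : IsRankingMeasureFunction Υ h ε) (σ : Scheduler Υ) (ρ : History Υ) :
    stepCost (ENNReal.ofReal ε) ρ.last.1 + ∑' s, stepProb σ ρ s * stackSum h s.1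
      ≤ stackSum h ρ.last.1 := by
  have h1 : ∑' s, stepProb σ ρ s * stackSum h s.1 =
      ∑' a, σ ρ a * ∑' s, trans Υ ρ.last a s * stackSum h s.1 := by
    unfold stepProb
    simp_rw [← ENNReal.tsum_mul_right, ← ENNReal.tsum_mul_left, mul_assoc]
    rw [ENNReal.tsum_comm]
  have h2 : stepCost (ENNReal.ofReal ε) ρ.last.1 =
      ∑' a, σ ρ a * stepCost (ENNReal.ofReal ε) ρ.last.1 := by
    rw [ENNReal.tsum_mul_right, PMF.tsum_coe, one_mul]
  rw [h1, h2, ← ENNReal.tsum_add]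
  simp_rw [← mul_add]
  exact PMF_tsum_mul_le _ fun a => hh.stepCost_add_tsum_trans_le _ _

/-! ### Integration along the path measure and telescoping -/

lemma lintegral_stepKernel (σ : Scheduler Υ) (ρ : History Υ) (g : W.State → ℝ≥0∞) :
    ∫⁻ s, g s ∂stepKernel σ ρ.len ρ.word = ∑' s, stepProb σ ρ s * g s := by
  rw [lintegral_countable']
  exact tsum_congr fun s => by rw [stepKernel_singleton, mul_comm]

lemma lintegral_pathMeasure_zero (σ : Scheduler Υ) (c : {c : W.StackElem // ¬ c.Terminal})
    (g : W.State → ℝ≥0∞) : ∫⁻ ω, g (ω 0) ∂pathMeasure σ c = g (initState c) := by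
  have := congrArg (fun m => ∫⁻ x, g (x ⟨0, Finset.mem_Iic.2 le_rfl⟩) ∂m) (pathMeasure_zero σ c)
  beta_reduce at this
  rw [lintegral_map (measurable_of_countable _) (by fun_prop), lintegral_dirac] at this
  exact this

/-- The joint law of the prefix up to time `n` and the next state is the law of the prefix composed
with the step kernel. -/
lemma lintegral_pathMeasure_succ (σ : Scheduler Υ) (c : {c : W.StackElem // ¬ c.Terminal})
    (n : ℕ) (g : W.State → ℝ≥0∞) :
    ∫⁻ ω, g (ω (n + 1)) ∂pathMeasure σ c =
      ∫⁻ ω, ∫⁻ s, g s ∂stepKernel σ n (fun i => ω i) ∂pathMeasure σ c := by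
  have key := ProbabilityTheory.Kernel.map_frestrictLe_trajMeasure_compProd_eq_map_trajMeasure
    (X := fun _ => W.State) (κ := stepKernel σ) (μ₀ := Measure.dirac (initState c)) (a := n)
  have := congrArg (fun m => ∫⁻ p, g p.2 ∂m) key
  beta_reduce at this
  rw [Measure.lintegral_compProd (measurable_of_countable _),
    lintegral_map (measurable_of_countable _) (by fun_prop),
    lintegral_map (measurable_of_countable _) (by fun_prop)] at this
  exact this.symm

lemma measurable_comp_coord (g : W.State → ℝ≥0∞) (n : ℕ) :
    Measurable fun ω : ℕ → W.State => g (ω n) :=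
  (measurable_of_countable g).comp (measurable_pi_apply n)

/-- The additive form avoids subtraction, since the integrals of the stack sum may be infinite. -/
lemma IsRankingMeasureFunction.lintegral_stepCost_add_le (hh : IsRankingMeasureFunction Υ h ε)
    (σ : Scheduler Υ) (c : {c : W.StackElem // ¬ c.Terminal}) (n : ℕ) :
    ∫⁻ ω, stepCost (ENNReal.ofReal ε) (ω n).1 ∂pathMeasure σ c +
        ∫⁻ ω, stackSum h (ω (n + 1)).1 ∂pathMeasure σ c
      ≤ ∫⁻ ω, stackSum h (ω n).1 ∂pathMeasure σ c := by
  rw [lintegral_pathMeasure_succ σ c n fun s => stackSum h s.1,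
    ← lintegral_add_left (measurable_comp_coord (fun s => stepCost (ENNReal.ofReal ε) s.1) n)]
  refine lintegral_mono_ae ?_
  -- The kernel follows the scheduler only on histories; almost every path is a run, so its prefixes
  -- are histories.
  filter_upwards [ae_isRun σ c] with ω hω
  let ρ : History Υ := ⟨n, fun i => ω i, fun k _ => hω.2 k⟩
  have := hh.stepCost_add_tsum_stepProb_le σ ρ
  rw [← lintegral_stepKernel] at this
  exact this

lemma IsRankingMeasureFunction.sum_lintegral_stepCost_add_le
    (hh : IsRankingMeasureFunction Υ h ε) (σ : Scheduler Υ)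
    (c : {c : W.StackElem // ¬ c.Terminal}) (n : ℕ) :
    ∑ k ∈ Finset.range n, ∫⁻ ω, stepCost (ENNReal.ofReal ε) (ω k).1 ∂pathMeasure σ c +
        ∫⁻ ω, stackSum h (ω n).1 ∂pathMeasure σ c ≤ h c.1 := by
  induction n with
  | zero =>
    rw [lintegral_pathMeasure_zero σ c fun s => stackSum h s.1]
    simp [initState]
  | succ n ih =>
    rw [Finset.sum_range_succ, add_assoc]
    refine le_trans ?_ ih
    gcongr
    exact hh.lintegral_stepCost_add_le σ c n

/-! ### Termination time as accumulated cost -/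

/-- Every step before termination starts from a nonempty stack and costs `e`. Only this lower bound
on the total cost is needed, so the steps after termination play no role. -/
lemma terminationTime_mul_le (e : ℝ≥0∞) (ω : Run Υ) :
    terminationTime ω * e ≤ ∑' n, stepCost e (ω.1 n).1 := by
  classical
  have hne : ∀ n, (ω.1 n).1 ≠ [] → stepCost e (ω.1 n).1 = e := by
    intro n hn
    obtain ⟨c, w, hw⟩ := List.exists_cons_of_ne_nil hn
    rw [hw]; rfl
  by_cases hex : ∃ n, (ω.1 n).1 = []
  · have hlt : ∀ k < Nat.find hex, (ω.1 k).1 ≠ [] := fun k hk => Nat.find_min hex hk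
    calc terminationTime ω * e ≤ (Nat.find hex : ℝ≥0∞) * e := by
          gcongr
          exact iInf₂_le (Nat.find hex) (Nat.find_spec hex)
      _ = ∑ k ∈ Finset.range (Nat.find hex), stepCost e (ω.1 k).1 := by
          rw [Finset.sum_congr rfl fun k hk => hne k (hlt k (Finset.mem_range.1 hk))]
          simp
      _ ≤ _ := ENNReal.sum_le_tsum _
  · push Not at hex
    rw [tsum_congr fun n => hne n (hex n)]
    -- On a nonterminating run the total cost is infinite, except for `e = 0`, where the convention
    -- `∞ * 0 = 0` applies.
    rcases eq_or_ne e 0 with rfl | he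
    · simp
    · rw [ENNReal.tsum_const_eq_top_of_ne_zero he]
      exact le_top

/-- The expected termination time, multiplied by the constant, is at most the value of the ranking
measure function. -/
lemma IsRankingMeasureFunction.lintegral_terminationTime_mul_le
    (hh : IsRankingMeasureFunction Υ h ε) (σ : Scheduler Υ)
    (c : {c : W.StackElem // ¬ c.Terminal}) :
    (∫⁻ ω, terminationTime ω ∂runMeasure σ c) * ENNReal.ofReal ε ≤ h c.1 := by
  calc (∫⁻ ω, terminationTime ω ∂runMeasure σ c) * ENNReal.ofReal ε
      = ∫⁻ ω, terminationTime ω * ENNReal.ofReal ε ∂runMeasure σ c :=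
        -- Finiteness of the constant stands in for measurability of the termination time.
        (lintegral_mul_const' _ _ ENNReal.ofReal_ne_top).symm
    _ ≤ ∫⁻ ω : Run Υ, ∑' n, stepCost (ENNReal.ofReal ε) (ω.1 n).1 ∂runMeasure σ c :=
        lintegral_mono fun ω => terminationTime_mul_le _ ω
    _ ≤ ∫⁻ ω, ∑' n, stepCost (ENNReal.ofReal ε) (ω n).1 ∂pathMeasure σ c := by
        unfold runMeasure
        refine (lintegral_subtype_comap (measurableSet_isRun Υ)
          (fun ω => ∑' n, stepCost (ENNReal.ofReal ε) (ω n).1)).trans_le ?_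
        exact setLIntegral_le_lintegral _ _
    _ = ∑' n, ∫⁻ ω, stepCost (ENNReal.ofReal ε) (ω n).1 ∂pathMeasure σ c :=
        lintegral_tsum fun n =>
          (measurable_comp_coord (fun s => stepCost (ENNReal.ofReal ε) s.1) n).aemeasurable
    -- The remaining potential at time `n` is dropped, leaving a bound uniform in `n`.
    _ ≤ h c.1 := ENNReal.tsum_le_of_sum_range_le fun n =>
        le_self_add.trans (hh.sum_lintegral_stepCost_add_le σ c n)

end Ranking

end CFG

end RecProg

theorem mainTheorem1 (W : RecProg.CFG) (Υ : W.SamplingFunction)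
    (h : W.StackElem → ENNReal) (ε : ℝ) (hh : RecProg.CFG.IsRankingMeasureFunction Υ h ε)
    (c : W.StackElem) :
    RecProg.CFG.supExpectedTime Υ c ≤ h c / ENNReal.ofReal ε := by
  unfold RecProg.CFG.supExpectedTime
  split_ifs with hc
  · exact zero_le
  · refine iSup_le fun σ => ?_
    rw [ENNReal.le_div_iff_mul_le (Or.inl (ENNReal.ofReal_pos.2 hh.pos).ne')
      (Or.inl ENNReal.ofReal_ne_top)]
    exact hh.lintegral_terminationTime_mul_le σ ⟨c, hc⟩
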